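/- **Setting.** Fix $q,r>0$, a sub-gaussian probability law $\mathcal D$ on $\mathbb R$ with bounded density, mean $0$ and variance $1$, a box $\Theta=[\underline a,\bar a]\times[\underline b,\bar b]$ with $0<\underline a\le\bar a$ and $0<\underline b\le\bar b$, and a constant $B$. For dynamics $\theta=(a,b)$, a controller $C:\mathbb R\to\mathbb R$ and i.i.d. noise $w_0,w_1,\dots\sim\mathcal D$, let $x_0=0$, $u_i=C(x_i)$, $x_{i+1}=ax_i+bu_i+w_i$, and for $t\ge 1$ $$J^*(\theta,C,t)=\mathbb E\Big[\frac1t\Big(q x_t^2+\sum_{i=0}^{t-1}(q x_i^2+r u_i^2)\Big)\Big].$$ For boundaries $D=(D_{\mathrm L},D_{\mathrm U})$ and $b>0$, the truncated linear controllers for $\theta$ are $C_K^\theta$, $K\in[\frac{a-1}{b},\frac ab]$, where $$C_K^\theta(x)=\begin{cases}-Kx & \text{if } D_{\mathrm L}\le (a-bK)x\le D_{\mathrm U},\\ (D_{\mathrm U}-ax)/b & \text{if } (a-bK)x>D_{\mathrm U},\\ (D_{\mathrm L}-ax)/b & \text{if } (a-bK)x<D_{\mathrm L},\end{cases}$$ and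 $K_{\mathrm{opt}}(\theta,t)$ denotes any minimizer of $K\mapsto J^*(\theta,C^\theta_K,t)$ over $[\frac{a-1}{b},\frac ab]$. **Lemma.** Let $\epsilon(T)=1/\log^{46}(T)$, so that $\epsilon(T)=\tilde\Omega_T(1)$. There are constants $T_0,k,M$, depending only on $q,r,\mathcal D,\Theta,B$, such that the following holds for all $T\ge T_0$, all $D_{\mathrm L}<0<D_{\mathrm U}$ with $|D_{\mathrm L}|,|D_{\mathrm U}|\le B$ and $D_{\mathrm U}-D_{\mathrm L}\ge 1/\log T$, all $\theta^*\in\Theta$, all $\theta\in\mathbb R^2$ with $\|\theta-\theta^*\|_\infty\le\epsilon(T)$, and all $1\le t\le T$: minimizers $K_{\mathrm{opt}}(\theta,t)$ and $K_{\mathrm{opt}}(\theta^*,t)$ exist, and for every choice of them $$\Big|J^*\big(\theta^*,C^{\theta}_{K_{\mathrm{opt}}(\theta,t)},t\big)-J^*\big(\theta^*,C^{\theta^*}_{K_{\mathrm{opt}}(\theta^*,t)},t\big)\Big|\le M\Big(\|\theta-\theta^*\|_\infty+\frac1{T^2}\Big)\log^k(T).$$ -/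

import Mathlib

open MeasureTheory ProbabilityTheory
open scoped ENNReal NNReal

namespace SafeLQR

/-- The law of one noise variable `w_t`: a sub-gaussian probability distribution on `ℝ` with a
bounded density, mean `0` and variance `1`. -/
structure IsNoiseLaw (𝒟 : Measure ℝ) : Prop where
  isProbabilityMeasure : IsProbabilityMeasure 𝒟
  bounded_density : ∃ (f : ℝ → ℝ≥0∞) (B : ℝ≥0), Measurable f ∧ (∀ x, f x ≤ B) ∧
    𝒟 = (volume : Measure ℝ).withDensity f
  mean_eq_zero : ∫ w, w ∂𝒟 = 0
  variance_eq_one : variance (fun w : ℝ => w) 𝒟 = 1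
  subgaussian : ∃ c : ℝ≥0, HasSubgaussianMGF (fun w : ℝ => w) c 𝒟

/-- Trajectory of the closed loop `u_t = C (x_t)`, `x_{t+1} = a x_t + b u_t + w_t` for the
dynamics `θ = (a, b)`, started at `x₀` and driven by the noise sequence `w`. -/
def state (θ : ℝ × ℝ) (C : ℝ → ℝ) (x₀ : ℝ) (w : ℕ → ℝ) : ℕ → ℝ
  | 0 => x₀
  | t + 1 => θ.1 * state θ C x₀ w t + θ.2 * C (state θ C x₀ w t) + w t

/-- Average cost over `T` steps: `(1/T) (q x_T² + ∑_{t < T} (q x_t² + r u_t²))`. -/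
noncomputable def avgCost (q r : ℝ) (θ : ℝ × ℝ) (C : ℝ → ℝ) (T : ℕ) (x₀ : ℝ) (w : ℕ → ℝ) : ℝ :=
  (1 / (T : ℝ)) * (q * state θ C x₀ w T ^ 2 +
    ∑ t ∈ Finset.range T,
      (q * state θ C x₀ w t ^ 2 + r * C (state θ C x₀ w t) ^ 2))

/-- Expected average cost over `T` steps started at `0`, the noise being i.i.d. with law `𝒟`. -/
noncomputable def expCost (q r : ℝ) (𝒟 : Measure ℝ) (θ : ℝ × ℝ) (C : ℝ → ℝ) (T : ℕ) : ℝ :=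
  ∫ w, avgCost q r θ C T 0 w ∂(Measure.infinitePi fun _ : ℕ => 𝒟)

/-- The truncated linear controller `C_K^θ` for the boundaries `D = (D_L, D_U)`. -/
noncomputable def truncLin (D θ : ℝ × ℝ) (K x : ℝ) : ℝ :=
  if D.2 < (θ.1 - θ.2 * K) * x then (D.2 - θ.1 * x) / θ.2
  else if (θ.1 - θ.2 * K) * x < D.1 then (D.1 - θ.1 * x) / θ.2
  else -K * x

/-- The parameters `K ∈ [(a-1)/b, a/b]` of the class of truncated linear controllers for `θ`. -/
def gainRange (θ : ℝ × ℝ) : Set ℝ := Set.Icc ((θ.1 - 1) / θ.2) (θ.1 / θ.2)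

/-- The set `argmin_{K ∈ [(a-1)/b, a/b]} J*(θ, C_K^θ, t)`; `K_opt(θ, t)` is any element of it. -/
def argminGain (q r : ℝ) (𝒟 : Measure ℝ) (D θ : ℝ × ℝ) (t : ℕ) : Set ℝ :=
  {K | K ∈ gainRange θ ∧
    IsMinOn (fun K' => expCost q r 𝒟 θ (truncLin D θ K') t) (gainRange θ) K}

/-- The safety boundaries `D = (D_L, D_U)` are admissible at horizon `T`, with bound `B` for
their absolute values. -/
structure IsBoundary (B : ℝ) (T : ℕ) (D : ℝ × ℝ) : Prop where
  lower_neg : D.1 < 0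
  upper_pos : 0 < D.2
  norm_le : ‖D‖ ≤ B
  width : 1 / Real.log T ≤ D.2 - D.1

/-- `f(T) = Ω̃_T(g(T))`. -/
def IsTildeOmega (f g : ℕ → ℝ) : Prop :=
  ∃ (T₀ k : ℕ) (M : ℝ), 0 < M ∧ ∀ T : ℕ, T₀ ≤ T → M * g T / Real.log T ^ k ≤ f T

/-- The radius `1 / log^46 T` around the true dynamics. -/
noncomputable def radius (T : ℕ) : ℝ := 1 / Real.log T ^ 46

end SafeLQR

namespace SafeLQR

/-! With `κ = a - bK`, the controller `C_K^θ` steers `x` to `sat D κ x` before the noise acts, and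
`K` ranges over the gain interval exactly when `κ` ranges over `[0, 1]`. So the closed loop of a
controller in its own dynamics depends on `κ` alone, and gains for `θ` and `θ*` are matched through
`κ`.

Put `ε = ‖θ - θ*‖ + 1/T²`. Two comparisons suffice. For matched controllers, each in its own
dynamics, the states coincide and the controls differ by `O(ε)(B + |x|)`
(`exists_abs_expCost_ctl_sub_le`). For one controller in both dynamics, the closed loop is perturbed
by `O(ε)(B + |x|)` (`exists_abs_expCost_sub_le`). Chaining these with the minimality of both gains
gives a bound `O(ε)`, without logarithms.

The second comparison needs stability uniform in time and in `κ`, including `κ = 1`, where `sat` is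
only nonexpansive. Saturation supplies it: when `κ` is near `1`, a long enough run of noise values
`≥ c > 0` pushes every copy of the process to the upper boundary, where copies with the same noise
merge; for smaller `κ` the map itself contracts. Such a run has a fixed positive probability and is
independent of the past, so the mean square deviation contracts from block to block and stays
`O(ε²)` (`exists_integral_traj_sub_sq_le`). -/

/-- The process `x_{t+1} = Φ (x_t) + w_t` started at `x₀`. -/
def traj (Φ : ℝ → ℝ) (x₀ : ℝ) (w : ℕ → ℝ) : ℕ → ℝ
  | 0 => x₀
  | t + 1 => Φ (traj Φ x₀ w t) + w t

/-- The linear map `x ↦ κ x` saturated to `[D_L, D_U]`. -/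
def sat (D : ℝ × ℝ) (κ x : ℝ) : ℝ := max D.1 (min D.2 (κ * x))

lemma traj_add (Φ : ℝ → ℝ) (x₀ : ℝ) (w : ℕ → ℝ) (i n : ℕ) :
    traj Φ x₀ w (i + n) = traj Φ (traj Φ x₀ w i) (fun j => w (i + j)) n := by
  induction n with
  | zero => rfl
  | succ n ih => rw [← add_assoc, traj, traj, ih]

lemma traj_congr_noise (Φ : ℝ → ℝ) (x₀ : ℝ) {w w' : ℕ → ℝ} {n : ℕ}
    (h : ∀ j < n, w j = w' j) : traj Φ x₀ w n = traj Φ x₀ w' n := by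
  induction n with
  | zero => rfl
  | succ n ih => rw [traj, traj, ih fun j hj => h j (hj.trans n.lt_succ_self), h n n.lt_succ_self]

lemma measurable_traj {Φ : ℝ → ℝ} (hΦ : Measurable Φ) (x₀ : ℝ) (n : ℕ) :
    Measurable fun w => traj Φ x₀ w n := by
  induction n with
  | zero => exact measurable_const
  | succ n ih => exact (hΦ.comp ih).add (measurable_pi_apply n)

lemma state_eq_traj {θ : ℝ × ℝ} {C Φ : ℝ → ℝ} (h : ∀ x, θ.1 * x + θ.2 * C x = Φ x)
    (x₀ : ℝ) (w : ℕ → ℝ) (n : ℕ) : state θ C x₀ w n = traj Φ x₀ w n := by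
  induction n with
  | zero => rfl
  | succ n ih => rw [state, traj, ih, h]

lemma continuous_sat (D : ℝ × ℝ) : Continuous fun p : ℝ × ℝ => sat D p.1 p.2 := by
  unfold sat; fun_prop

lemma measurable_sat (D : ℝ × ℝ) (κ : ℝ) : Measurable (sat D κ) :=
  ((continuous_sat D).comp (Continuous.prodMk_right κ)).measurable

/-- The two truncated branches are the saturated values of `sat`; `K` enters only through `κ = a -
bK`. -/
lemma truncLin_eq {D θ : ℝ × ℝ} (hD : D.1 ≤ D.2) (hθ : θ.2 ≠ 0) (K x : ℝ) :
    truncLin D θ K x = (sat D (θ.1 - θ.2 * K) x - θ.1 * x) / θ.2 := by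
  unfold truncLin sat
  split_ifs with h₁ h₂
  · rw [min_eq_left h₁.le, max_eq_right hD]
  · rw [min_eq_right (h₂.le.trans hD), max_eq_left h₂.le]
  · rw [min_eq_right (not_lt.1 h₁), max_eq_right (not_lt.1 h₂)]
    field_simp
    ring

/-! ### Pathwise contraction of the saturated process -/

section sat

variable {D : ℝ × ℝ} {B κ : ℝ}

lemma abs_sat_le (h₁ : |D.1| ≤ B) (h₂ : |D.2| ≤ B) (x : ℝ) : |sat D κ x| ≤ B := by
  rw [abs_le] at *
  refine ⟨h₁.1.trans (le_max_left _ _), max_le h₁.2 ((min_le_left _ _).trans h₂.2)⟩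

lemma abs_sat_sub_sat_le (hκ : 0 ≤ κ) (x y : ℝ) : |sat D κ x - sat D κ y| ≤ κ * |x - y| := by
  have h : |κ * x - κ * y| = κ * |x - y| := by rw [← mul_sub, abs_mul, abs_of_nonneg hκ]
  rw [← h]
  exact (abs_max_sub_max_le_max _ _ _ _).trans
    (max_le (by simp) ((abs_min_sub_min_le_max _ _ _ _).trans (by simp)))

lemma abs_traj_sat_sub_le (hκ : 0 ≤ κ) (x y : ℝ) (w : ℕ → ℝ) (n : ℕ) :
    |traj (sat D κ) x w n - traj (sat D κ) y w n| ≤ κ ^ n * |x - y| := by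
  induction n with
  | zero => simp [traj]
  | succ n ih =>
    calc |traj (sat D κ) x w (n + 1) - traj (sat D κ) y w (n + 1)|
        = |sat D κ (traj (sat D κ) x w n) - sat D κ (traj (sat D κ) y w n)| := by
          simp only [traj]; congr 1; ring
      _ ≤ κ * |traj (sat D κ) x w n - traj (sat D κ) y w n| := abs_sat_sub_sat_le hκ _ _
      _ ≤ κ * (κ ^ n * |x - y|) := by gcongr
      _ = κ ^ (n + 1) * |x - y| := by ring

/-- A run of noise values bounded below by `c > 0` drives the saturated process to its upper
boundary, when the gain is close to `1`. -/
lemma min_le_sat_traj (h₁ : |D.1| ≤ B) (h₂ : |D.2| ≤ B) {c η : ℝ} (hc : 0 < c) (hη : 0 ≤ η)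
    (hηc : η * (B + c) ≤ c / 2) (hκ : 1 - η ≤ κ) (hκ' : κ ≤ 1) (hκ0 : 0 ≤ κ)
    (x : ℝ) (w : ℕ → ℝ) (n : ℕ) (hw : ∀ j < n, c ≤ w j) :
    min D.2 (-B + n * (c / 2)) ≤ sat D κ (traj (sat D κ) x w n) := by
  induction n with
  | zero =>
    refine (min_le_right _ _).trans ?_
    simpa using (abs_le.1 (abs_sat_le (κ := κ) h₁ h₂ (traj (sat D κ) x w 0))).1
  | succ n ih =>
    have ih := ih fun j hj => hw j (hj.trans n.lt_succ_self)
    have hv := abs_le.1 (abs_sat_le (κ := κ) h₁ h₂ (traj (sat D κ) x w n))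
    simp only [traj]
    set v := sat D κ (traj (sat D κ) x w n)
    have hwn : κ * (v + c) ≤ κ * (v + w n) :=
      mul_le_mul_of_nonneg_left (by linarith [hw n n.lt_succ_self]) hκ0
    -- If `v + c ≥ 0`, the gain loses at most `η (B + c) ≤ c / 2`; if `v + c < 0`, multiplying by `κ
    -- ≤ 1` only raises it.
    have hstep : v + c / 2 ≤ κ * (v + c) := by
      rcases le_total 0 (v + c) with h | h
      · have := mul_le_mul_of_nonneg_right hκ h
        have := mul_le_mul_of_nonneg_left (show v + c ≤ B + c by linarith [hv.2]) hη
        linarith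
      · nlinarith
    refine le_trans ?_ (le_max_right _ _)
    refine le_min (min_le_left _ _) ?_
    push_cast
    rcases min_le_iff.1 ih with h | h
    · exact (min_le_left _ _).trans (by linarith)
    · exact (min_le_right _ _).trans (by linarith)

/-- Two copies of the saturated process driven by the same noise contract over a block of noise
values bounded below by `c`, whatever the gain `κ ∈ [0, 1]`. -/
lemma abs_traj_sat_sub_le_of_noise_ge (h₁ : |D.1| ≤ B) (h₂ : |D.2| ≤ B) {c η : ℝ} (hc : 0 < c)
    (hη : 0 ≤ η) (hη1 : η ≤ 1) (hηc : η * (B + c) ≤ c / 2) (hκ0 : 0 ≤ κ) (hκ' : κ ≤ 1) {n : ℕ}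
    (hn : 2 * B ≤ n * (c / 2)) (x y : ℝ) (w : ℕ → ℝ) (hw : ∀ j < n + 1, c ≤ w j) :
    |traj (sat D κ) x w (n + 1) - traj (sat D κ) y w (n + 1)| ≤ (1 - η) * |x - y| := by
  rcases le_total κ (1 - η) with h | h
  · refine (abs_traj_sat_sub_le hκ0 x y w (n + 1)).trans ?_
    gcongr
    exact (pow_le_of_le_one hκ0 hκ' n.succ_ne_zero).trans h
  -- Climbing from `-B` by `c / 2` per step passes `B ≥ D.2` within `n` steps. Both copies then have
  -- the same saturated value, so they agree after one more step.
  · have key : ∀ z, D.2 ≤ sat D κ (traj (sat D κ) z w n) := fun z => by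
      refine le_trans (le_min le_rfl ?_) (min_le_sat_traj h₁ h₂ hc hη hηc h hκ' hκ0 z w n
        fun j hj => hw j (hj.trans n.lt_succ_self))
      linarith [(abs_le.1 h₂).2]
    have key' : ∀ z, sat D κ (traj (sat D κ) z w n) = max D.1 D.2 := fun z => by
      refine le_antisymm (max_le_max le_rfl (min_le_left _ _)) (max_le (le_max_left _ _) (key z))
    simp only [traj, key', sub_self, abs_zero]
    exact mul_nonneg (by linarith) (abs_nonneg _)

/-- Deviation of a perturbed process from the saturated one. -/
lemma abs_traj_sub_traj_sat_le (hκ0 : 0 ≤ κ) (hκ' : κ ≤ 1) {Φ : ℝ → ℝ} {δ : ℝ}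
    (hΦ : ∀ x, |Φ x - sat D κ x| ≤ δ * (B + |x|)) (x : ℝ) (w : ℕ → ℝ) (n : ℕ) :
    |traj Φ x w n - traj (sat D κ) x w n|
      ≤ ∑ j ∈ Finset.range n, δ * (B + |traj Φ x w j|) := by
  induction n with
  | zero => simp [traj]
  | succ n ih =>
    rw [Finset.sum_range_succ]
    have h₁ := hΦ (traj Φ x w n)
    have h₂ := abs_sat_sub_sat_le (D := D) hκ0 (traj Φ x w n) (traj (sat D κ) x w n)
    have h₃ := mul_le_of_le_one_left (abs_nonneg (traj Φ x w n - traj (sat D κ) x w n)) hκ'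
    calc |traj Φ x w (n + 1) - traj (sat D κ) x w (n + 1)|
        = |(Φ (traj Φ x w n) - sat D κ (traj Φ x w n))
            + (sat D κ (traj Φ x w n) - sat D κ (traj (sat D κ) x w n))| := by
          simp only [traj]; congr 1; ring
      _ ≤ _ := (abs_add_le _ _).trans (by linarith)

end sat

/-! ### I.i.d. noise and blocks of large values -/

/-- The law of an i.i.d. noise sequence. -/
noncomputable abbrev noise (𝒟 : Measure ℝ) : Measure (ℕ → ℝ) := Measure.infinitePi fun _ : ℕ => 𝒟

section noise

variable {𝒟 : Measure ℝ}

/-- The variance of a function outside `L²` is `0` by convention, so variance `1` forces square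
integrability. -/
lemma IsNoiseLaw.memLp (h : IsNoiseLaw 𝒟) : MemLp (fun w : ℝ => w) 2 𝒟 := by
  have := h.isProbabilityMeasure
  by_contra hc
  have h1 := h.variance_eq_one
  rw [variance_of_not_memLp (by fun_prop) hc] at h1
  exact zero_ne_one h1

lemma IsNoiseLaw.integral_sq (h : IsNoiseLaw 𝒟) : ∫ w, w ^ 2 ∂𝒟 = 1 := by
  rw [← h.variance_eq_one, variance_of_integral_eq_zero (by fun_prop) h.mean_eq_zero]

/-- Otherwise the noise is almost surely `≤ 0`; mean `0` then makes it vanish, contradicting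
variance `1`. -/
lemma IsNoiseLaw.exists_pos (h : IsNoiseLaw 𝒟) : ∃ c : ℝ, 0 < c ∧ 0 < 𝒟.real (Set.Ici c) := by
  have := h.isProbabilityMeasure
  by_contra! hc
  have h0 : ∀ n : ℕ, ∀ᵐ w ∂𝒟, w < 1 / ((n : ℝ) + 1) := fun n => by
    have h1 := le_antisymm (hc (1 / ((n : ℝ) + 1)) (by positivity)) measureReal_nonneg
    rw [measureReal_eq_zero_iff] at h1
    simpa [ae_iff, Set.Ici] using h1
  have h1 : ∀ᵐ w ∂𝒟, w ≤ 0 := by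
    filter_upwards [ae_all_iff.2 h0] with w hw
    by_contra! hpos
    obtain ⟨n, hn⟩ := exists_nat_one_div_lt hpos
    exact lt_asymm (hw n) hn
  have h2 : (fun w : ℝ => -w) =ᵐ[𝒟] 0 := by
    refine (integral_eq_zero_iff_of_nonneg_ae ?_ ?_).1 ?_
    · filter_upwards [h1] with w hw using by simpa using hw
    · exact (h.memLp.integrable (by norm_num)).neg
    · rw [integral_neg, h.mean_eq_zero, neg_zero]
  have h3 : ∫ w, w ^ 2 ∂𝒟 = 0 := by
    refine integral_eq_zero_of_ae ?_
    filter_upwards [h2] with w hw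
    have : w = 0 := by simpa using hw
    simp [this]
  linarith [h.integral_sq]

variable [IsProbabilityMeasure 𝒟]

lemma IsNoiseLaw.memLp_eval (h : IsNoiseLaw 𝒟) (i : ℕ) :
    MemLp (fun w : ℕ → ℝ => w i) 2 (noise 𝒟) :=
  h.memLp.comp_measurePreserving (measurePreserving_eval_infinitePi (fun _ : ℕ => 𝒟) i)

lemma IsNoiseLaw.integral_eval_sq (h : IsNoiseLaw 𝒟) (i : ℕ) :
    ∫ w, w i ^ 2 ∂noise 𝒟 = 1 := by
  have hmap := integral_map (μ := noise 𝒟) (φ := fun w : ℕ → ℝ => w i)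
    (measurable_pi_apply i).aemeasurable (f := fun x : ℝ => x ^ 2) (by fun_prop)
  rw [← hmap, Measure.infinitePi_map_eval (fun _ : ℕ => 𝒟) i, h.integral_sq]

/-- The event that the noise is at least `c` in the `N` steps from `i` on. -/
def blockEvent (c : ℝ) (i N : ℕ) : Set (ℕ → ℝ) := {w | ∀ j < N, c ≤ w (i + j)}

lemma blockEvent_eq_pi (c : ℝ) (i N : ℕ) :
    blockEvent c i N = Set.pi (Finset.Ico i (i + N) : Set ℕ) fun _ => Set.Ici c := by
  ext w
  simp only [blockEvent, Set.mem_ofPred_eq, Set.mem_pi, Finset.coe_Ico, Set.mem_Ico, Set.mem_Ici]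
  refine ⟨fun h j hj => ?_, fun h j hj => h (i + j) (by omega)⟩
  have := h (j - i) (by omega)
  rwa [Nat.add_sub_cancel' hj.1] at this

lemma measurableSet_blockEvent (c : ℝ) (i N : ℕ) : MeasurableSet (blockEvent c i N) := by
  rw [blockEvent_eq_pi]
  exact MeasurableSet.pi (Finset.countable_toSet _) fun _ _ => measurableSet_Ici

lemma noise_real_blockEvent (c : ℝ) (i N : ℕ) :
    (noise 𝒟).real (blockEvent c i N) = 𝒟.real (Set.Ici c) ^ N := by
  rw [blockEvent_eq_pi, Measure.real, Measure.infinitePi_pi _ fun _ _ => measurableSet_Ici]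
  simp [Measure.real]

/-- The noise of a block is independent of what precedes the block. -/
lemma integral_blockEvent_mul {Y : (ℕ → ℝ) → ℝ} (hY : Measurable Y) {i : ℕ}
    (hYi : ∀ w w' : ℕ → ℝ, (∀ j < i, w j = w' j) → Y w = Y w') (c : ℝ) (N : ℕ) :
    ∫ w, (blockEvent c i N).indicator 1 w * Y w ∂noise 𝒟
      = 𝒟.real (Set.Ici c) ^ N * ∫ w, Y w ∂noise 𝒟 := by
  have hind : iIndepFun (fun (i : ℕ) (w : ℕ → ℝ) => w i) (noise 𝒟) :=
    iIndepFun_infinitePi (P := fun _ : ℕ => 𝒟) (X := fun _ w => w) fun _ => measurable_id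
  have h := hind.indepFun_finset (Finset.Ico i (i + N)) (Finset.range i)
    (by rw [Finset.disjoint_left]; intro j; simp only [Finset.mem_Ico, Finset.mem_range]; omega)
    fun j => measurable_pi_apply j
  -- Extension by `0` turns functions of a sequence into functions of finitely many coordinates, so
  -- that independence of finite families applies.
  let extend (S : Finset ℕ) (v : S → ℝ) (j : ℕ) : ℝ := if hj : j ∈ S then v ⟨j, hj⟩ else 0
  have hext (S : Finset ℕ) : Measurable (extend S) := by
    refine measurable_pi_lambda _ fun j => ?_
    by_cases hj : j ∈ S
    · simpa [extend, hj] using measurable_pi_apply _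
    · simp [extend, hj]
  have hI : Measurable ((blockEvent c i N).indicator (1 : (ℕ → ℝ) → ℝ)) :=
    measurable_one.indicator (measurableSet_blockEvent c i N)
  have h' := h.comp (hI.comp (hext (Finset.Ico i (i + N)))) (hY.comp (hext (Finset.range i)))
  have e₁ : ((blockEvent c i N).indicator (1 : (ℕ → ℝ) → ℝ) ∘ extend (Finset.Ico i (i + N))) ∘
      (fun (w : ℕ → ℝ) (j : Finset.Ico i (i + N)) => w j)
      = (blockEvent c i N).indicator (1 : (ℕ → ℝ) → ℝ) := by
    funext w
    have : extend (Finset.Ico i (i + N)) (fun j => w j) ∈ blockEvent c i N ↔ w ∈ blockEvent c i N := by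
      refine forall₂_congr fun j hj => ?_
      simp [extend, hj]
    by_cases hw : w ∈ blockEvent c i N
    · simp [hw, this.2 hw]
    · simp [hw, mt this.1 hw]
  have e₂ : (Y ∘ extend (Finset.range i)) ∘ (fun (w : ℕ → ℝ) (j : Finset.range i) => w j) = Y := by
    funext w
    exact hYi _ _ fun j hj => by simp [extend, hj]
  rw [e₁, e₂] at h'
  rw [h'.integral_fun_mul_eq_mul_integral hI.aestronglyMeasurable hY.aestronglyMeasurable,
    integral_indicator_one (measurableSet_blockEvent c i N), noise_real_blockEvent]

end noise

/-! ### Second moments, uniformly in time -/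

section moments

variable {𝒟 : Measure ℝ} [IsProbabilityMeasure 𝒟] {D : ℝ × ℝ} {B κ δ : ℝ} {Φ : ℝ → ℝ}

lemma abs_le_of_abs_sub_sat_le (h₁ : |D.1| ≤ B) (h₂ : |D.2| ≤ B)
    (hΦ : ∀ x, |Φ x - sat D κ x| ≤ δ * (B + |x|)) (x : ℝ) : |Φ x| ≤ B + δ * (B + |x|) := by
  have := abs_add_le (Φ x - sat D κ x) (sat D κ x)
  rw [sub_add_cancel] at this
  linarith [hΦ x, abs_sat_le (κ := κ) h₁ h₂ x]

lemma memLp_traj (h𝒟 : IsNoiseLaw 𝒟) (hΦm : Measurable Φ)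
    (hΦ : ∀ x, |Φ x| ≤ B + δ * (B + |x|)) (i : ℕ) :
    MemLp (fun w => traj Φ 0 w i) 2 (noise 𝒟) := by
  induction i with
  | zero => simpa only [traj] using memLp_const 0
  | succ i ih =>
    have h : MemLp (fun w => B + δ * (B + |traj Φ 0 w i|)) 2 (noise 𝒟) :=
      (memLp_const B).add (((memLp_const B).add ih.abs).const_mul δ)
    refine MemLp.add (h.mono (hΦm.comp (measurable_traj hΦm 0 i)).aestronglyMeasurable ?_)
      (h𝒟.memLp_eval i)
    refine Filter.Eventually.of_forall fun w => ?_
    simp only [Real.norm_eq_abs]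
    exact (hΦ _).trans (le_abs_self _)

/-- Since `|Φ x| ≤ B + (B + |x|) / 4`, one step sends a second moment `m` to at most `4 B² + m / 2 +
3`, whose fixed point is `8 B² + 6`. -/
lemma integral_traj_sq_le (h𝒟 : IsNoiseLaw 𝒟) (hB : 0 ≤ B) (hδ' : δ ≤ 1 / 4)
    (hΦm : Measurable Φ) (hΦ : ∀ x, |Φ x| ≤ B + δ * (B + |x|)) (i : ℕ) :
    ∫ w, traj Φ 0 w i ^ 2 ∂noise 𝒟 ≤ 8 * B ^ 2 + 6 := by
  induction i with
  | zero => simp only [traj]; simp; positivity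
  | succ i ih =>
    have hi := (memLp_traj h𝒟 hΦm hΦ i).integrable_sq
    have hw := (h𝒟.memLp_eval i).integrable_sq
    have hs : Integrable (fun w => 4 * B ^ 2 + 1 / 2 * traj Φ 0 w i ^ 2) (noise 𝒟) :=
      (integrable_const _).add (hi.const_mul _)
    have hpt : ∀ w : ℕ → ℝ, traj Φ 0 w (i + 1) ^ 2
        ≤ (4 * B ^ 2 + 1 / 2 * traj Φ 0 w i ^ 2) + 3 * w i ^ 2 := fun w => by
      simp only [traj]
      set x := traj Φ 0 w i
      have hx : |Φ x| ≤ B + 1 / 4 * (B + |x|) :=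
        (hΦ x).trans (by gcongr)
      have h₁ : Φ x ^ 2 ≤ (B + 1 / 4 * (B + |x|)) ^ 2 := sq_le_sq.2 (hx.trans (le_abs_self _))
      nlinarith [sq_abs x, sq_nonneg (Φ x - 2 * w i), sq_nonneg (B - |x|), sq_nonneg (5 * B - |x|)]
    calc ∫ w, traj Φ 0 w (i + 1) ^ 2 ∂noise 𝒟
        ≤ ∫ w, ((4 * B ^ 2 + 1 / 2 * traj Φ 0 w i ^ 2) + 3 * w i ^ 2) ∂noise 𝒟 :=
          integral_mono (memLp_traj h𝒟 hΦm hΦ (i + 1)).integrable_sq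
            (hs.add (hw.const_mul _)) hpt
      _ = 4 * B ^ 2 + 1 / 2 * ∫ w, traj Φ 0 w i ^ 2 ∂noise 𝒟 + 3 := by
          rw [integral_add hs (hw.const_mul _),
            integral_add (integrable_const _) (hi.const_mul _), integral_const,
            integral_const_mul, integral_const_mul, h𝒟.integral_eval_sq]
          simp
      _ ≤ 8 * B ^ 2 + 6 := by linarith

end moments

/-! ### Mean square stability under perturbation -/

section coupling

variable {𝒟 : Measure ℝ} [IsProbabilityMeasure 𝒟] {D : ℝ × ℝ} {B κ δ : ℝ} {Φ : ℝ → ℝ}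

/-- Second moment of the perturbation accumulated over `n` steps. -/
lemma integral_sum_perturbation_sq_le (h𝒟 : IsNoiseLaw 𝒟) (hB : 0 ≤ B) (hδ' : δ ≤ 1 / 4)
    (hΦm : Measurable Φ) (hΦ : ∀ x, |Φ x| ≤ B + δ * (B + |x|)) (i n : ℕ) :
    Integrable (fun w => (∑ j ∈ Finset.range n, δ * (B + |traj Φ 0 w (i + j)|)) ^ 2) (noise 𝒟) ∧
    ∫ w, (∑ j ∈ Finset.range n, δ * (B + |traj Φ 0 w (i + j)|)) ^ 2 ∂noise 𝒟
      ≤ (n : ℝ) ^ 2 * (18 * B ^ 2 + 12) * δ ^ 2 := by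
  have hL (j : ℕ) : MemLp (fun w => δ * (B + |traj Φ 0 w (i + j)|)) 2 (noise 𝒟) :=
    ((memLp_const B).add (memLp_traj h𝒟 hΦm hΦ (i + j)).abs).const_mul δ
  have hS : MemLp (fun w => ∑ j ∈ Finset.range n, δ * (B + |traj Φ 0 w (i + j)|)) 2 (noise 𝒟) :=
    memLp_finsetSum _ fun j _ => hL j
  refine ⟨hS.integrable_sq, ?_⟩
  have hterm (j : ℕ) : ∫ w, (δ * (B + |traj Φ 0 w (i + j)|)) ^ 2 ∂noise 𝒟
      ≤ (18 * B ^ 2 + 12) * δ ^ 2 := by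
    have hi := (memLp_traj h𝒟 hΦm hΦ (i + j)).integrable_sq
    calc ∫ w, (δ * (B + |traj Φ 0 w (i + j)|)) ^ 2 ∂noise 𝒟
        ≤ ∫ w, (2 * B ^ 2 * δ ^ 2 + 2 * δ ^ 2 * traj Φ 0 w (i + j) ^ 2) ∂noise 𝒟 := by
          refine integral_mono (hL j).integrable_sq
            ((integrable_const _).add (hi.const_mul _)) fun w => ?_
          have := mul_nonneg (sq_nonneg δ) (sq_nonneg (B - |traj Φ 0 w (i + j)|))
          rw [← sq_abs (traj Φ 0 w (i + j))]
          nlinarith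
      _ = 2 * B ^ 2 * δ ^ 2 + 2 * δ ^ 2 * ∫ w, traj Φ 0 w (i + j) ^ 2 ∂noise 𝒟 := by
          rw [integral_add (integrable_const _) (hi.const_mul _), integral_const, integral_const_mul]
          simp
      _ ≤ 2 * B ^ 2 * δ ^ 2 + 2 * δ ^ 2 * (8 * B ^ 2 + 6) := by
          gcongr
          exact integral_traj_sq_le h𝒟 hB hδ' hΦm hΦ (i + j)
      _ = (18 * B ^ 2 + 12) * δ ^ 2 := by ring
  calc ∫ w, (∑ j ∈ Finset.range n, δ * (B + |traj Φ 0 w (i + j)|)) ^ 2 ∂noise 𝒟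
      ≤ ∫ w, n * ∑ j ∈ Finset.range n, (δ * (B + |traj Φ 0 w (i + j)|)) ^ 2 ∂noise 𝒟 := by
        refine integral_mono hS.integrable_sq
          ((integrable_finsetSum _ fun j _ => (hL j).integrable_sq).const_mul _) fun w => ?_
        simpa using sq_sum_le_card_mul_sum_sq (s := Finset.range n)
          (f := fun j => δ * (B + |traj Φ 0 w (i + j)|))
    _ = n * ∑ j ∈ Finset.range n, ∫ w, (δ * (B + |traj Φ 0 w (i + j)|)) ^ 2 ∂noise 𝒟 := by
        rw [integral_const_mul, integral_finsetSum _ fun j _ => (hL j).integrable_sq]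
    _ ≤ n * ∑ _j ∈ Finset.range n, (18 * B ^ 2 + 12) * δ ^ 2 := by
        gcongr with j _
        exact hterm j
    _ = (n : ℝ) ^ 2 * (18 * B ^ 2 + 12) * δ ^ 2 := by simp; ring

/-- Pathwise contraction over one block of the difference between a perturbed process and the
saturated process driven by the same noise. -/
lemma sq_traj_sub_le_block (h₁ : |D.1| ≤ B) (h₂ : |D.2| ≤ B) {c η s : ℝ} (hc : 0 < c)
    (hη : 0 ≤ η) (hη1 : η ≤ 1) (hηc : η * (B + c) ≤ c / 2) (hκ0 : 0 ≤ κ) (hκ' : κ ≤ 1) {n : ℕ}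
    (hn : 2 * B ≤ n * (c / 2)) (hs : 0 < s) (hΦ : ∀ x, |Φ x - sat D κ x| ≤ δ * (B + |x|))
    (w : ℕ → ℝ) (i : ℕ) :
    (traj Φ 0 w (i + (n + 1)) - traj (sat D κ) 0 w (i + (n + 1))) ^ 2
      ≤ (1 + s) * ((traj Φ 0 w i - traj (sat D κ) 0 w i) ^ 2
          - η * ((blockEvent c i (n + 1)).indicator 1 w
            * (traj Φ 0 w i - traj (sat D κ) 0 w i) ^ 2))
        + (1 + 1 / s) * (∑ j ∈ Finset.range (n + 1), δ * (B + |traj Φ 0 w (i + j)|)) ^ 2 := by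
  set e := traj Φ 0 w i - traj (sat D κ) 0 w i with he
  set G := ∑ j ∈ Finset.range (n + 1), δ * (B + |traj Φ 0 w (i + j)|) with hG
  set f := traj Φ 0 w (i + (n + 1)) - traj (sat D κ) 0 w (i + (n + 1)) with hf
  set m := traj (sat D κ) (traj Φ 0 w i) (fun j => w (i + j)) (n + 1)
    - traj (sat D κ) (traj (sat D κ) 0 w i) (fun j => w (i + j)) (n + 1) with hm
  -- Inserted between the two is the saturated process restarted at time `i` from the perturbed
  -- state: `m` is the contracted old error, `G` the error made within the block.
  have hfm : |f| ≤ |m| + G := by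
    have h := abs_traj_sub_traj_sat_le hκ0 hκ' hΦ (traj Φ 0 w i) (fun j => w (i + j)) (n + 1)
    simp only [← traj_add Φ] at h
    have hf' : f = (traj Φ 0 w (i + (n + 1))
        - traj (sat D κ) (traj Φ 0 w i) (fun j => w (i + j)) (n + 1)) + m := by
      rw [hf, hm, traj_add (sat D κ) 0 w i (n + 1)]; ring
    rw [hf']
    refine (abs_add_le _ _).trans ?_
    linarith
  have hme : m ^ 2 ≤ e ^ 2 - η * ((blockEvent c i (n + 1)).indicator 1 w * e ^ 2) := by
    by_cases hw : w ∈ blockEvent c i (n + 1)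
    · have h : |m| ≤ (1 - η) * |e| := abs_traj_sat_sub_le_of_noise_ge h₁ h₂ hc hη hη1 hηc hκ0 hκ'
        hn _ _ _ hw
      have h' : m ^ 2 ≤ ((1 - η) * |e|) ^ 2 := sq_le_sq.2 (h.trans (le_abs_self _))
      rw [mul_pow, sq_abs] at h'
      simp only [hw, Set.indicator_of_mem, Pi.one_apply, one_mul]
      nlinarith [mul_nonneg (mul_nonneg hη (sub_nonneg.2 hη1)) (sq_nonneg e)]
    · have h : |m| ≤ κ ^ (n + 1) * |e| := abs_traj_sat_sub_le hκ0 _ _ _ _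
      have h' : |m| ≤ |e| := h.trans (mul_le_of_le_one_left (abs_nonneg _) (pow_le_one₀ hκ0 hκ'))
      simpa [hw] using sq_le_sq.2 h'
  have hsq : f ^ 2 ≤ (|m| + G) ^ 2 := sq_le_sq.2 (hfm.trans (le_abs_self _))
  have hyoung : (|m| + G) ^ 2 ≤ (1 + s) * m ^ 2 + (1 + 1 / s) * G ^ 2 := by
    have h : (1 + s) * m ^ 2 + (1 + 1 / s) * G ^ 2 - (|m| + G) ^ 2 = (s * |m| - G) ^ 2 / s := by
      rw [← sq_abs m]; field_simp; ring
    have : 0 ≤ (s * |m| - G) ^ 2 / s := by positivity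
    linarith
  have := mul_le_mul_of_nonneg_left hme (show (0 : ℝ) ≤ 1 + s by linarith)
  linarith

/-- A perturbation of size `δ` of the saturated process changes its state by `O(δ)` in mean
square, uniformly in time. -/
theorem exists_integral_traj_sub_sq_le (h𝒟 : IsNoiseLaw 𝒟) (hB : 0 ≤ B) :
    ∃ M : ℝ, 0 ≤ M ∧ ∀ (D : ℝ × ℝ) (κ δ : ℝ) (Φ : ℝ → ℝ), |D.1| ≤ B → |D.2| ≤ B →
      0 ≤ κ → κ ≤ 1 → δ ≤ 1 / 4 → Measurable Φ →
      (∀ x, |Φ x - sat D κ x| ≤ δ * (B + |x|)) → ∀ i : ℕ,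
        ∫ w, (traj Φ 0 w i - traj (sat D κ) 0 w i) ^ 2 ∂noise 𝒟 ≤ M * δ ^ 2 := by
  obtain ⟨c, hc, hp⟩ := h𝒟.exists_pos
  obtain ⟨n, hn⟩ := exists_nat_ge (2 * B / (c / 2))
  rw [div_le_iff₀ (by positivity)] at hn
  obtain ⟨η, hη, hη1, hηc⟩ : ∃ η : ℝ, 0 < η ∧ η ≤ 1 ∧ η * (B + c) ≤ c / 2 := by
    refine ⟨c / 2 / (B + c), by positivity, ?_, ?_⟩
    · rw [div_le_one (by positivity)]; linarith
    · rw [div_mul_cancel₀]; positivity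
  set p := 𝒟.real (Set.Ici c) ^ (n + 1) with hpdef
  have hp0 : 0 < p := by positivity
  have hp1 : p ≤ 1 := pow_le_one₀ measureReal_nonneg measureReal_le_one
  -- This choice makes `(1 + s)(1 - η p) = (1 + s)(1 - 2 s) ≤ 1 - s`: the Young factor uses up only
  -- part of the contraction.
  set s := η * p / 2 with hsdef
  have hs : 0 < s := by positivity
  have hs1 : s ≤ 1 := by nlinarith
  set Γ := ((n + 1 : ℕ) : ℝ) ^ 2 * (18 * B ^ 2 + 12) with hΓdef
  have hΓ : 0 ≤ Γ := by positivity
  -- Times `δ²`, this is the fixed point of the block recursion `E ↦ (1 - s) E + (1 + 1 / s) Γ δ²`.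
  refine ⟨(1 + 1 / s) * Γ / s, by positivity, ?_⟩
  intro D κ δ Φ h₁ h₂ hκ0 hκ1 hδ hΦm hΦ
  have hΦ' := abs_le_of_abs_sub_sat_le h₁ h₂ hΦ
  have hF : ∀ x, |sat D κ x| ≤ B + 0 * (B + |x|) := fun x => by simpa using abs_sat_le h₁ h₂ x
  have hL (i : ℕ) : MemLp (fun w => traj Φ 0 w i - traj (sat D κ) 0 w i) 2 (noise 𝒟) :=
    (memLp_traj h𝒟 hΦm hΦ' i).sub (memLp_traj h𝒟 (measurable_sat D κ) hF i)
  intro i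
  -- The recursion goes back `n + 1` steps; at earlier times the perturbations are simply summed.
  induction i using Nat.strong_induction_on with
  | _ i ih =>
  rcases lt_or_ge i (n + 1) with hi | hi
  · have hG := integral_sum_perturbation_sq_le h𝒟 hB hδ hΦm hΦ' 0 i
    simp only [zero_add] at hG
    have hin : (i : ℝ) ≤ ((n + 1 : ℕ) : ℝ) := by exact_mod_cast hi.le
    have hle : 1 ≤ (1 + 1 / s) / s := by
      rw [le_div_iff₀ hs]
      have : 0 < 1 / s := by positivity
      linarith
    calc ∫ w, (traj Φ 0 w i - traj (sat D κ) 0 w i) ^ 2 ∂noise 𝒟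
        ≤ ∫ w, (∑ j ∈ Finset.range i, δ * (B + |traj Φ 0 w j|)) ^ 2 ∂noise 𝒟 :=
          integral_mono (hL i).integrable_sq hG.1 fun w => sq_le_sq.2
            ((abs_traj_sub_traj_sat_le hκ0 hκ1 hΦ 0 w i).trans (le_abs_self _))
      _ ≤ (i : ℝ) ^ 2 * (18 * B ^ 2 + 12) * δ ^ 2 := hG.2
      _ ≤ Γ * δ ^ 2 := by rw [hΓdef]; gcongr
      _ ≤ (1 + 1 / s) / s * (Γ * δ ^ 2) := le_mul_of_one_le_left (by positivity) hle
      _ = (1 + 1 / s) * Γ / s * δ ^ 2 := by ring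
  · obtain ⟨i, rfl⟩ := Nat.exists_eq_add_of_le' hi
    have ih := ih i (by omega)
    have hG := integral_sum_perturbation_sq_le h𝒟 hB hδ hΦm hΦ' i (n + 1)
    have hE := (hL i).integrable_sq
    have hYm : Measurable fun w => (traj Φ 0 w i - traj (sat D κ) 0 w i) ^ 2 :=
      ((measurable_traj hΦm 0 i).sub (measurable_traj (measurable_sat D κ) 0 i)).pow_const 2
    have hind := integral_blockEvent_mul (𝒟 := 𝒟) hYm (i := i) (fun w w' h => by
      rw [traj_congr_noise Φ 0 h, traj_congr_noise (sat D κ) 0 h]) c (n + 1)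
    have hIE : Integrable (fun w => (blockEvent c i (n + 1)).indicator 1 w
        * (traj Φ 0 w i - traj (sat D κ) 0 w i) ^ 2) (noise 𝒟) := by
      refine hE.mono ((measurable_one.indicator (measurableSet_blockEvent c i (n + 1))).mul
        hYm).aestronglyMeasurable (Filter.Eventually.of_forall fun w => ?_)
      by_cases hw : w ∈ blockEvent c i (n + 1) <;> simp [hw, sq_nonneg]
    have hsub : Integrable (fun w => (traj Φ 0 w i - traj (sat D κ) 0 w i) ^ 2
        - η * ((blockEvent c i (n + 1)).indicator 1 w
          * (traj Φ 0 w i - traj (sat D κ) 0 w i) ^ 2)) (noise 𝒟) := hE.sub (hIE.const_mul η)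
    set E := ∫ w, (traj Φ 0 w i - traj (sat D κ) 0 w i) ^ 2 ∂noise 𝒟 with hEdef
    have hE0 : 0 ≤ E := integral_nonneg fun w => sq_nonneg _
    calc ∫ w, (traj Φ 0 w (i + (n + 1)) - traj (sat D κ) 0 w (i + (n + 1))) ^ 2 ∂noise 𝒟
        ≤ ∫ w, ((1 + s) * ((traj Φ 0 w i - traj (sat D κ) 0 w i) ^ 2
          - η * ((blockEvent c i (n + 1)).indicator 1 w
            * (traj Φ 0 w i - traj (sat D κ) 0 w i) ^ 2))
        + (1 + 1 / s) * (∑ j ∈ Finset.range (n + 1), δ * (B + |traj Φ 0 w (i + j)|)) ^ 2)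
          ∂noise 𝒟 :=
          integral_mono (hL _).integrable_sq ((hsub.const_mul _).add (hG.1.const_mul _)) fun w =>
            sq_traj_sub_le_block h₁ h₂ hc hη.le hη1 hηc hκ0 hκ1 hn hs hΦ w i
      _ = (1 + s) * (E - η * (p * E)) + (1 + 1 / s) *
          ∫ w, (∑ j ∈ Finset.range (n + 1), δ * (B + |traj Φ 0 w (i + j)|)) ^ 2 ∂noise 𝒟 := by
          rw [integral_add (hsub.const_mul _) (hG.1.const_mul _), integral_const_mul,
            integral_const_mul, integral_sub hE (hIE.const_mul η), integral_const_mul, hind]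
      _ ≤ (1 - s) * E + (1 + 1 / s) * (Γ * δ ^ 2) := by
          have h1 : (1 + s) * (E - η * (p * E)) = (1 - s - 2 * s ^ 2) * E := by
            rw [hsdef]; ring
          have h2 := mul_le_mul_of_nonneg_left hG.2 (show 0 ≤ 1 + 1 / s by positivity)
          have h3 := mul_nonneg (sq_nonneg s) hE0
          linarith
      _ ≤ (1 - s) * ((1 + 1 / s) * Γ / s * δ ^ 2) + (1 + 1 / s) * (Γ * δ ^ 2) := by
          have := sub_nonneg.2 hs1
          gcongr
      _ = (1 + 1 / s) * Γ / s * δ ^ 2 := by field_simp; ring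

end coupling

/-! ### From mean square distances to costs -/

section cost

variable {𝒟 : Measure ℝ}

/-- Write `X² - Y² = (X - Y)(X + Y)` and apply Young's inequality with weight `ε`; both resulting
terms are of order `ε`. -/
lemma abs_integral_sq_sub_le {Ω : Type*} [MeasurableSpace Ω] {μ : Measure Ω} {X Y : Ω → ℝ}
    (hX : MemLp X 2 μ) (hY : MemLp Y 2 μ) {ε M m : ℝ} (hε : 0 < ε)
    (hXY : ∫ ω, (X ω - Y ω) ^ 2 ∂μ ≤ M * ε ^ 2) (hXm : ∫ ω, X ω ^ 2 ∂μ ≤ m)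
    (hYm : ∫ ω, Y ω ^ 2 ∂μ ≤ m) :
    |∫ ω, X ω ^ 2 ∂μ - ∫ ω, Y ω ^ 2 ∂μ| ≤ (M / 2 + 2 * m) * ε := by
  have hd : Integrable (fun ω => (X ω - Y ω) ^ 2) μ := (hX.sub hY).integrable_sq
  have hs : Integrable (fun ω => X ω ^ 2 + Y ω ^ 2) μ := hX.integrable_sq.add hY.integrable_sq
  rw [← integral_sub hX.integrable_sq hY.integrable_sq]
  calc |∫ ω, (X ω ^ 2 - Y ω ^ 2) ∂μ| ≤ ∫ ω, |X ω ^ 2 - Y ω ^ 2| ∂μ := abs_integral_le_integral_abs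
    _ ≤ ∫ ω, (1 / (2 * ε) * (X ω - Y ω) ^ 2 + ε * (X ω ^ 2 + Y ω ^ 2)) ∂μ := by
        refine integral_mono (hX.integrable_sq.sub hY.integrable_sq).abs
          ((hd.const_mul _).add (hs.const_mul _)) fun ω => ?_
        have key : ∀ u v : ℝ, u * v ≤ 1 / (2 * ε) * u ^ 2 + ε / 2 * v ^ 2 := fun u v => by
          have h : 1 / (2 * ε) * u ^ 2 + ε / 2 * v ^ 2 - u * v
              = (u - ε * v) ^ 2 / (2 * ε) := by field_simp; ring
          have : 0 ≤ (u - ε * v) ^ 2 / (2 * ε) := by positivity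
          linarith
        have h0 := mul_nonneg hε.le (sq_nonneg (X ω - Y ω))
        refine abs_le.2 ⟨?_, ?_⟩
        · have := key (X ω - Y ω) (-(X ω + Y ω)); dsimp only; nlinarith
        · have := key (X ω - Y ω) (X ω + Y ω); dsimp only; nlinarith
    _ = 1 / (2 * ε) * ∫ ω, (X ω - Y ω) ^ 2 ∂μ
          + ε * (∫ ω, X ω ^ 2 ∂μ + ∫ ω, Y ω ^ 2 ∂μ) := by
        rw [integral_add (hd.const_mul _) (hs.const_mul _), integral_const_mul,
          integral_const_mul, integral_add hX.integrable_sq hY.integrable_sq]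
    _ ≤ 1 / (2 * ε) * (M * ε ^ 2) + ε * (m + m) := by gcongr
    _ = (M / 2 + 2 * m) * ε := by field_simp; ring

lemma expCost_eq (q r : ℝ) {θ : ℝ × ℝ} {C Φ : ℝ → ℝ} (h : ∀ x, θ.1 * x + θ.2 * C x = Φ x)
    (hx : ∀ i, MemLp (fun w => traj Φ 0 w i) 2 (noise 𝒟))
    (hu : ∀ i, MemLp (fun w => C (traj Φ 0 w i)) 2 (noise 𝒟)) (t : ℕ) :
    expCost q r 𝒟 θ C t = 1 / (t : ℝ) * (q * ∫ w, traj Φ 0 w t ^ 2 ∂noise 𝒟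
      + ∑ i ∈ Finset.range t, (q * ∫ w, traj Φ 0 w i ^ 2 ∂noise 𝒟
        + r * ∫ w, C (traj Φ 0 w i) ^ 2 ∂noise 𝒟)) := by
  have hi (i : ℕ) : Integrable
      (fun w => q * traj Φ 0 w i ^ 2 + r * C (traj Φ 0 w i) ^ 2) (noise 𝒟) :=
    ((hx i).integrable_sq.const_mul q).add ((hu i).integrable_sq.const_mul r)
  unfold expCost avgCost
  simp only [state_eq_traj h]
  rw [integral_const_mul, integral_add ((hx t).integrable_sq.const_mul q)
    (integrable_finsetSum _ fun i _ => hi i), integral_const_mul,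
    integral_finsetSum _ fun i _ => hi i]
  congr 2
  refine Finset.sum_congr rfl fun i _ => ?_
  rw [integral_add ((hx i).integrable_sq.const_mul q) ((hu i).integrable_sq.const_mul r),
    integral_const_mul, integral_const_mul]

/-- The terminal cost makes `t + 1` state terms for a divisor `t`; `(t + 1) / t ≤ 2` gives the
factor `2 q`. -/
lemma abs_average_sub_le {q r : ℝ} (hq : 0 ≤ q) (hr : 0 ≤ r) {x y u v : ℕ → ℝ} {α β : ℝ}
    (hxy : ∀ i, |x i - y i| ≤ α) (huv : ∀ i, |u i - v i| ≤ β) {t : ℕ} (ht : 1 ≤ t) :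
    |1 / (t : ℝ) * (q * x t + ∑ i ∈ Finset.range t, (q * x i + r * u i))
      - 1 / (t : ℝ) * (q * y t + ∑ i ∈ Finset.range t, (q * y i + r * v i))|
      ≤ 2 * q * α + r * β := by
  have ht' : (1 : ℝ) ≤ t := by exact_mod_cast ht
  have hα : 0 ≤ α := (abs_nonneg _).trans (hxy 0)
  have h₁ (i : ℕ) : |q * (x i - y i)| ≤ q * α := by
    rw [abs_mul, abs_of_nonneg hq]; exact mul_le_mul_of_nonneg_left (hxy i) hq
  have h₂ (i : ℕ) : |r * (u i - v i)| ≤ r * β := by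
    rw [abs_mul, abs_of_nonneg hr]; exact mul_le_mul_of_nonneg_left (huv i) hr
  have h₃ : |∑ i ∈ Finset.range t, (q * (x i - y i) + r * (u i - v i))|
      ≤ t * (q * α + r * β) := by
    refine (Finset.abs_sum_le_sum_abs _ _).trans ?_
    refine (Finset.sum_le_card_nsmul _ _ (q * α + r * β) fun i _ =>
      (abs_add_le _ _).trans (add_le_add (h₁ i) (h₂ i))).trans ?_
    rw [Finset.card_range, nsmul_eq_mul]
  have e : 1 / (t : ℝ) * (q * x t + ∑ i ∈ Finset.range t, (q * x i + r * u i))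
      - 1 / (t : ℝ) * (q * y t + ∑ i ∈ Finset.range t, (q * y i + r * v i))
      = 1 / (t : ℝ) * (q * (x t - y t)
        + ∑ i ∈ Finset.range t, (q * (x i - y i) + r * (u i - v i))) := by
    have : ∑ i ∈ Finset.range t, (q * (x i - y i) + r * (u i - v i))
        = ∑ i ∈ Finset.range t, (q * x i + r * u i)
          - ∑ i ∈ Finset.range t, (q * y i + r * v i) := by
      rw [← Finset.sum_sub_distrib]
      exact Finset.sum_congr rfl fun i _ => by ring
    rw [this]; ring
  rw [e, abs_mul, abs_of_nonneg (by positivity), one_div, inv_mul_le_iff₀ (by positivity)]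
  refine (abs_add_le _ _).trans ((add_le_add (h₁ t) h₃).trans ?_)
  nlinarith [mul_nonneg hq hα]

end cost

/-! ### Controls as functions of the closed-loop gain -/

section control

variable {D : ℝ × ℝ} {B : ℝ}

/-- The control that steers the dynamics `θ` from `x` to `sat D κ x` before the noise acts. -/
noncomputable def ctl (D θ : ℝ × ℝ) (κ x : ℝ) : ℝ := (sat D κ x - θ.1 * x) / θ.2

lemma measurable_ctl (D θ : ℝ × ℝ) (κ : ℝ) : Measurable (ctl D θ κ) :=
  ((measurable_sat D κ).sub (measurable_id.const_mul _)).div_const _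

lemma closedLoop_ctl {θ : ℝ × ℝ} (hθ : θ.2 ≠ 0) (κ x : ℝ) :
    θ.1 * x + θ.2 * ctl D θ κ x = sat D κ x := by
  unfold ctl; field_simp; ring

lemma abs_ctl_le (h₁ : |D.1| ≤ B) (h₂ : |D.2| ≤ B) (hB : 0 ≤ B) {θ : ℝ × ℝ} {a b : ℝ}
    (ha : |θ.1| ≤ a) (hb : 0 < b) (hbθ : b ≤ θ.2) (κ x : ℝ) :
    |ctl D θ κ x| ≤ (1 + a) / b * (B + |x|) := by
  have h : |sat D κ x - θ.1 * x| ≤ (1 + a) * (B + |x|) := by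
    have h₃ := abs_sub (sat D κ x) (θ.1 * x)
    rw [abs_mul] at h₃
    have h₄ := mul_le_mul_of_nonneg_right ha (abs_nonneg x)
    nlinarith [abs_sat_le (κ := κ) h₁ h₂ x, abs_nonneg x, (abs_nonneg θ.1).trans ha]
  have hc : 0 ≤ (1 + a) * (B + |x|) := (abs_nonneg _).trans h
  rw [ctl, abs_div, abs_of_pos (hb.trans_le hbθ), div_mul_eq_mul_div]
  gcongr

lemma abs_ctl_sub_le {θ : ℝ × ℝ} {a b κ : ℝ} (ha : |θ.1| ≤ a) (hb : 0 < b) (hbθ : b ≤ θ.2)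
    (hκ0 : 0 ≤ κ) (hκ1 : κ ≤ 1) (x y : ℝ) :
    |ctl D θ κ x - ctl D θ κ y| ≤ (1 + a) / b * |x - y| := by
  have h : |(sat D κ x - sat D κ y) - θ.1 * (x - y)| ≤ (1 + a) * |x - y| := by
    have h₃ := abs_sub (sat D κ x - sat D κ y) (θ.1 * (x - y))
    rw [abs_mul] at h₃
    have h₄ := mul_le_mul_of_nonneg_right ha (abs_nonneg (x - y))
    have h₅ := (abs_sat_sub_sat_le (D := D) hκ0 x y).trans
      (mul_le_of_le_one_left (abs_nonneg _) hκ1)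
    linarith
  have hc : 0 ≤ (1 + a) * |x - y| := (abs_nonneg _).trans h
  have e : ctl D θ κ x - ctl D θ κ y
      = ((sat D κ x - sat D κ y) - θ.1 * (x - y)) / θ.2 := by
    unfold ctl; ring
  rw [e, abs_div, abs_of_pos (hb.trans_le hbθ), div_mul_eq_mul_div]
  gcongr

/-- The control depends on the dynamics in a Lipschitz way. -/
lemma abs_ctl_sub_ctl_le (h₁ : |D.1| ≤ B) (h₂ : |D.2| ≤ B) {θ θs : ℝ × ℝ}
    {a b b' ε : ℝ} (ha : |θs.1| ≤ a) (hb : 0 < b) (hbθ : b ≤ θ.2) (hbs : b ≤ θs.2)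
    (hbs' : θs.2 ≤ b') (hε : ‖θ - θs‖ ≤ ε) (κ x : ℝ) :
    |ctl D θ κ x - ctl D θs κ x| ≤ (1 + a + b') / b ^ 2 * ε * (B + |x|) := by
  have hε₁ : |θ.1 - θs.1| ≤ ε := (norm_fst_le (θ - θs)).trans hε
  have hε₂ : |θ.2 - θs.2| ≤ ε := (norm_snd_le (θ - θs)).trans hε
  have hθ := hb.trans_le hbθ
  have hθs := hb.trans_le hbs
  have hε0 : 0 ≤ ε := (norm_nonneg _).trans hε
  have hB : 0 ≤ B := (abs_nonneg _).trans h₁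
  have ha0 : 0 ≤ a := (abs_nonneg _).trans ha
  -- The saturated target is common to both controls, so the numerator is linear in `θ - θs`.
  have e : ctl D θ κ x - ctl D θs κ x
      = (-(θ.2 - θs.2) * sat D κ x + (θs.1 * (θ.2 - θs.2) - θs.2 * (θ.1 - θs.1)) * x)
        / (θ.2 * θs.2) := by
    unfold ctl; field_simp; ring
  have hnum : |-(θ.2 - θs.2) * sat D κ x + (θs.1 * (θ.2 - θs.2) - θs.2 * (θ.1 - θs.1)) * x|
      ≤ (1 + a + b') * ε * (B + |x|) := by
    have k₁ : |-(θ.2 - θs.2) * sat D κ x| ≤ ε * B := by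
      rw [abs_mul, abs_neg]
      exact mul_le_mul hε₂ (abs_sat_le h₁ h₂ x) (abs_nonneg _) hε0
    have k₂ : |θs.1 * (θ.2 - θs.2) - θs.2 * (θ.1 - θs.1)| ≤ a * ε + b' * ε := by
      refine (abs_sub _ _).trans (add_le_add ?_ ?_)
      · rw [abs_mul]; exact mul_le_mul ha hε₂ (abs_nonneg _) ha0
      · rw [abs_mul, abs_of_pos hθs]
        exact mul_le_mul hbs' hε₁ (abs_nonneg _) (hθs.le.trans hbs')
    have k₃ : |(θs.1 * (θ.2 - θs.2) - θs.2 * (θ.1 - θs.1)) * x| ≤ (a * ε + b' * ε) * |x| := by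
      rw [abs_mul]; exact mul_le_mul_of_nonneg_right k₂ (abs_nonneg _)
    have hb0 : 0 ≤ b' := hθs.le.trans hbs'
    have k₄ : 0 ≤ (a + b') * ε * B := by positivity
    have k₅ : 0 ≤ ε * |x| := by positivity
    refine (abs_add_le _ _).trans ((add_le_add k₁ k₃).trans ?_)
    linarith
  have hc : 0 ≤ (1 + a + b') * ε * (B + |x|) := (abs_nonneg _).trans hnum
  rw [e, abs_div, abs_of_pos (mul_pos hθ hθs), div_mul_eq_mul_div, div_mul_eq_mul_div]
  gcongr
  rw [pow_two]
  gcongr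

end control

/-- Transfers second moments from states to controls and their differences, via `(B + |x|)² ≤ 2 B² +
2 x²`. -/
lemma memLp_and_integral_sq_le_of_abs_le {Ω : Type*} [MeasurableSpace Ω] {μ : Measure Ω}
    [IsProbabilityMeasure μ] {X V : Ω → ℝ} {B L m : ℝ} (hX : MemLp X 2 μ)
    (hXm : ∫ ω, X ω ^ 2 ∂μ ≤ m) (hV : Measurable V) (h : ∀ ω, |V ω| ≤ L * (B + |X ω|)) :
    MemLp V 2 μ ∧ ∫ ω, V ω ^ 2 ∂μ ≤ L ^ 2 * (2 * B ^ 2 + 2 * m) := by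
  have hL : MemLp (fun ω => L * (B + |X ω|)) 2 μ := ((memLp_const B).add hX.abs).const_mul L
  have hVL : MemLp V 2 μ := hL.mono hV.aestronglyMeasurable
    (Filter.Eventually.of_forall fun ω => (h ω).trans (le_abs_self _))
  refine ⟨hVL, ?_⟩
  have hs := hX.integrable_sq
  calc ∫ ω, V ω ^ 2 ∂μ ≤ ∫ ω, (L ^ 2 * (2 * B ^ 2) + L ^ 2 * 2 * X ω ^ 2) ∂μ := by
        refine integral_mono hVL.integrable_sq ((integrable_const _).add (hs.const_mul _))
          fun ω => ?_
        have h₁ : V ω ^ 2 ≤ (L * (B + |X ω|)) ^ 2 := sq_le_sq.2 ((h ω).trans (le_abs_self _))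
        have h₂ := mul_nonneg (sq_nonneg L) (sq_nonneg (B - |X ω|))
        dsimp only
        rw [← sq_abs (X ω)]
        nlinarith
    _ = L ^ 2 * (2 * B ^ 2) + L ^ 2 * 2 * ∫ ω, X ω ^ 2 ∂μ := by
        rw [integral_add (integrable_const _) (hs.const_mul _), integral_const,
          integral_const_mul]
        simp
    _ ≤ L ^ 2 * (2 * B ^ 2) + L ^ 2 * 2 * m := by gcongr
    _ = L ^ 2 * (2 * B ^ 2 + 2 * m) := by ring

/-! ### The two cost comparisons -/

section compare

variable {𝒟 : Measure ℝ} [IsProbabilityMeasure 𝒟] {B : ℝ}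

/-- With the closed loop kept fixed, the expected cost is Lipschitz in the dynamics. -/
theorem exists_abs_expCost_ctl_sub_le (h𝒟 : IsNoiseLaw 𝒟) {q r : ℝ} (hq : 0 ≤ q) (hr : 0 ≤ r)
    (B a b b' : ℝ) (hb : 0 < b) :
    ∃ M : ℝ, ∀ (D θ θs : ℝ × ℝ) (κ ε : ℝ) (t : ℕ), |D.1| ≤ B → |D.2| ≤ B → |θ.1| ≤ a →
      |θs.1| ≤ a → b ≤ θ.2 → b ≤ θs.2 → θs.2 ≤ b' → 0 < ε → ‖θ - θs‖ ≤ ε → 1 ≤ t →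
      |expCost q r 𝒟 θ (ctl D θ κ) t - expCost q r 𝒟 θs (ctl D θs κ) t| ≤ M * ε := by
  set m := 8 * B ^ 2 + 6
  set L := (1 + a) / b
  set c := (1 + a + b') / b ^ 2
  set m' := 2 * B ^ 2 + 2 * m
  refine ⟨r * (c ^ 2 * m' / 2 + 2 * (L ^ 2 * m')), ?_⟩
  intro D θ θs κ ε t h₁ h₂ ha has hbθ hbs hbs' hε hθ ht
  have hB : 0 ≤ B := (abs_nonneg _).trans h₁
  have hF : ∀ x, |sat D κ x| ≤ B + 0 * (B + |x|) := fun x => by simpa using abs_sat_le h₁ h₂ x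
  have hx := memLp_traj h𝒟 (measurable_sat D κ) hF
  have hxm := integral_traj_sq_le h𝒟 hB (by norm_num) (measurable_sat D κ) hF
  have hmeas (ϑ : ℝ × ℝ) (i : ℕ) : Measurable fun w => ctl D ϑ κ (traj (sat D κ) 0 w i) :=
    (measurable_ctl D ϑ κ).comp (measurable_traj (measurable_sat D κ) 0 i)
  have hu (i : ℕ) := memLp_and_integral_sq_le_of_abs_le (hx i) (hxm i) (hmeas θ i)
    fun w => abs_ctl_le h₁ h₂ hB ha hb hbθ κ _
  have hv (i : ℕ) := memLp_and_integral_sq_le_of_abs_le (hx i) (hxm i) (hmeas θs i)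
    fun w => abs_ctl_le h₁ h₂ hB has hb hbs κ _
  have hd (i : ℕ) := memLp_and_integral_sq_le_of_abs_le (hx i) (hxm i)
    ((hmeas θ i).sub (hmeas θs i))
    fun w => abs_ctl_sub_ctl_le h₁ h₂ has hb hbθ hbs hbs' hθ κ _
  rw [expCost_eq q r (closedLoop_ctl (hb.trans_le hbθ).ne' κ) hx fun i => (hu i).1,
    expCost_eq q r (closedLoop_ctl (hb.trans_le hbs).ne' κ) hx fun i => (hv i).1]
  -- The closed loops coincide, so the state terms contribute `0`.
  have e : r * (c ^ 2 * m' / 2 + 2 * (L ^ 2 * m')) * ε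
      = 2 * q * 0 + r * ((c ^ 2 * m' / 2 + 2 * (L ^ 2 * m')) * ε) := by ring
  rw [e]
  refine abs_average_sub_le hq hr (x := fun i => ∫ w, traj (sat D κ) 0 w i ^ 2 ∂noise 𝒟)
    (y := fun i => ∫ w, traj (sat D κ) 0 w i ^ 2 ∂noise 𝒟)
    (u := fun i => ∫ w, ctl D θ κ (traj (sat D κ) 0 w i) ^ 2 ∂noise 𝒟)
    (v := fun i => ∫ w, ctl D θs κ (traj (sat D κ) 0 w i) ^ 2 ∂noise 𝒟)
    (fun i => by simp) (fun i => ?_) ht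
  refine abs_integral_sq_sub_le (hu i).1 (hv i).1 hε ((hd i).2.trans ?_) (hu i).2 (hv i).2
  rw [mul_pow]
  exact le_of_eq (by ring)

/-- With the controller kept fixed, the expected cost is Lipschitz in the dynamics. -/
theorem exists_abs_expCost_sub_le (h𝒟 : IsNoiseLaw 𝒟) {q r : ℝ} (hq : 0 ≤ q) (hr : 0 ≤ r)
    (hB : 0 ≤ B) (a b b' : ℝ) (hb : 0 < b) :
    ∃ M : ℝ, ∀ (D θ θs : ℝ × ℝ) (κ ε : ℝ) (t : ℕ), |D.1| ≤ B → |D.2| ≤ B → |θ.1| ≤ a →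
      |θs.1| ≤ a → b ≤ θ.2 → b ≤ θs.2 → θs.2 ≤ b' → 0 ≤ κ → κ ≤ 1 → 0 < ε → ‖θ - θs‖ ≤ ε →
      b' * ((1 + a + b') / b ^ 2) * ε ≤ 1 / 4 → 1 ≤ t →
      |expCost q r 𝒟 θs (ctl D θ κ) t - expCost q r 𝒟 θ (ctl D θ κ) t| ≤ M * ε := by
  obtain ⟨M, _, hM⟩ := exists_integral_traj_sub_sq_le h𝒟 hB
  set m := 8 * B ^ 2 + 6
  set L := (1 + a) / b
  set c := (1 + a + b') / b ^ 2
  set m' := 2 * B ^ 2 + 2 * m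
  set M' := M * (b' * c) ^ 2
  refine ⟨2 * q * (M' / 2 + 2 * m) + r * (L ^ 2 * M' / 2 + 2 * (L ^ 2 * m')), ?_⟩
  intro D θ θs κ ε t h₁ h₂ ha has hbθ hbs hbs' hκ0 hκ1 hε hθ hsmall ht
  have hF : ∀ x, |sat D κ x| ≤ B + 0 * (B + |x|) := fun x => by simpa using abs_sat_le h₁ h₂ x
  have hx := memLp_traj h𝒟 (measurable_sat D κ) hF
  have hxm := integral_traj_sq_le h𝒟 hB (by norm_num) (measurable_sat D κ) hF
  -- The controller built for `θ`, run in the dynamics `θs`.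
  set Φ : ℝ → ℝ := fun x => θs.1 * x + θs.2 * ctl D θ κ x with hΦdef
  have hΦm : Measurable Φ :=
    (measurable_id.const_mul _).add ((measurable_ctl D θ κ).const_mul _)
  have hθs : 0 < θs.2 := hb.trans_le hbs
  have hΦ : ∀ x, |Φ x - sat D κ x| ≤ b' * c * ε * (B + |x|) := fun x => by
    have e : Φ x - sat D κ x = θs.2 * (ctl D θ κ x - ctl D θs κ x) := by
      rw [hΦdef, ← closedLoop_ctl (D := D) hθs.ne' κ x]; ring
    rw [e, abs_mul, abs_of_pos hθs]
    have h := abs_ctl_sub_ctl_le h₁ h₂ has hb hbθ hbs hbs' hθ κ x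
    calc θs.2 * |ctl D θ κ x - ctl D θs κ x| ≤ b' * (c * ε * (B + |x|)) :=
          mul_le_mul hbs' h (abs_nonneg _) (hθs.le.trans hbs')
      _ = b' * c * ε * (B + |x|) := by ring
  have hΦ' := abs_le_of_abs_sub_sat_le h₁ h₂ hΦ
  have hy := memLp_traj h𝒟 hΦm hΦ'
  have hym := integral_traj_sq_le h𝒟 hB hsmall hΦm hΦ'
  have hum (i : ℕ) : Measurable fun w => ctl D θ κ (traj (sat D κ) 0 w i) :=
    (measurable_ctl D θ κ).comp (measurable_traj (measurable_sat D κ) 0 i)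
  have hvm (i : ℕ) : Measurable fun w => ctl D θ κ (traj Φ 0 w i) :=
    (measurable_ctl D θ κ).comp (measurable_traj hΦm 0 i)
  have hu (i : ℕ) := memLp_and_integral_sq_le_of_abs_le (hx i) (hxm i) (hum i)
    fun w => abs_ctl_le h₁ h₂ hB ha hb hbθ κ _
  have hv (i : ℕ) := memLp_and_integral_sq_le_of_abs_le (hy i) (hym i) (hvm i)
    fun w => abs_ctl_le h₁ h₂ hB ha hb hbθ κ _
  have hE (i : ℕ) : ∫ w, (traj Φ 0 w i - traj (sat D κ) 0 w i) ^ 2 ∂noise 𝒟 ≤ M' * ε ^ 2 :=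
    (hM D κ _ Φ h₁ h₂ hκ0 hκ1 hsmall hΦm hΦ i).trans (le_of_eq (by ring))
  have hEu (i : ℕ) : ∫ w, (ctl D θ κ (traj Φ 0 w i) - ctl D θ κ (traj (sat D κ) 0 w i)) ^ 2
      ∂noise 𝒟 ≤ L ^ 2 * M' * ε ^ 2 := by
    calc ∫ w, (ctl D θ κ (traj Φ 0 w i) - ctl D θ κ (traj (sat D κ) 0 w i)) ^ 2 ∂noise 𝒟
        ≤ ∫ w, L ^ 2 * (traj Φ 0 w i - traj (sat D κ) 0 w i) ^ 2 ∂noise 𝒟 := by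
          refine integral_mono ((hv i).1.sub (hu i).1).integrable_sq
            (((hy i).sub (hx i)).integrable_sq.const_mul _) fun w => ?_
          dsimp only
          rw [← sq_abs (traj Φ 0 w i - traj (sat D κ) 0 w i), ← mul_pow]
          exact sq_le_sq.2 ((abs_ctl_sub_le ha hb hbθ hκ0 hκ1 _ _).trans (le_abs_self _))
      _ ≤ L ^ 2 * (M' * ε ^ 2) := by
          rw [integral_const_mul]
          exact mul_le_mul_of_nonneg_left (hE i) (sq_nonneg L)
      _ = L ^ 2 * M' * ε ^ 2 := by ring
  rw [expCost_eq q r (fun _ => rfl : ∀ x, θs.1 * x + θs.2 * ctl D θ κ x = Φ x) hy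
      fun i => (hv i).1,
    expCost_eq q r (closedLoop_ctl (hb.trans_le hbθ).ne' κ) hx fun i => (hu i).1]
  have e : (2 * q * (M' / 2 + 2 * m) + r * (L ^ 2 * M' / 2 + 2 * (L ^ 2 * m'))) * ε
      = 2 * q * ((M' / 2 + 2 * m) * ε) + r * ((L ^ 2 * M' / 2 + 2 * (L ^ 2 * m')) * ε) := by ring
  rw [e]
  refine abs_average_sub_le hq hr (x := fun i => ∫ w, traj Φ 0 w i ^ 2 ∂noise 𝒟)
    (y := fun i => ∫ w, traj (sat D κ) 0 w i ^ 2 ∂noise 𝒟)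
    (u := fun i => ∫ w, ctl D θ κ (traj Φ 0 w i) ^ 2 ∂noise 𝒟)
    (v := fun i => ∫ w, ctl D θ κ (traj (sat D κ) 0 w i) ^ 2 ∂noise 𝒟)
    (fun i => ?_) (fun i => ?_) ht
  · exact abs_integral_sq_sub_le (hy i) (hx i) hε (hE i) (hym i) (hxm i)
  · exact abs_integral_sq_sub_le (hv i).1 (hu i).1 hε (hEu i) (hv i).2 (hu i).2

end compare

/-! ### Existence of minimizers -/

section existence

variable {𝒟 : Measure ℝ} [IsProbabilityMeasure 𝒟] {B : ℝ}

lemma continuous_traj_sat (D : ℝ × ℝ) (w : ℕ → ℝ) (i : ℕ) :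
    Continuous fun κ => traj (sat D κ) 0 w i := by
  induction i with
  | zero => exact continuous_const
  | succ i ih =>
    exact ((continuous_sat D).comp (continuous_id.prodMk ih)).add continuous_const

/-- Supplies a dominating function independent of `κ`. At `i = 0` the index `i - 1` is `0`, harmless
because the state is `0`. -/
lemma abs_traj_sat_le {D : ℝ × ℝ} (h₁ : |D.1| ≤ B) (h₂ : |D.2| ≤ B) (κ : ℝ) (w : ℕ → ℝ) (i : ℕ) :
    |traj (sat D κ) 0 w i| ≤ B + |w (i - 1)| := by
  cases i with
  | zero =>
    have : 0 ≤ B := (abs_nonneg _).trans h₁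
    simp only [traj, abs_zero]; positivity
  | succ i =>
    exact (abs_add_le _ _).trans (add_le_add (abs_sat_le h₁ h₂ _) le_rfl)

/-- Dominated convergence: each path is continuous in `κ`, and saturation bounds each state by the
latest noise alone. -/
lemma continuous_expCost_ctl (h𝒟 : IsNoiseLaw 𝒟) {q r : ℝ} (hq : 0 ≤ q) (hr : 0 ≤ r)
    {D θ : ℝ × ℝ} (h₁ : |D.1| ≤ B) (h₂ : |D.2| ≤ B) (hθ : 0 < θ.2) (t : ℕ) :
    Continuous fun κ => expCost q r 𝒟 θ (ctl D θ κ) t := by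
  have hB : 0 ≤ B := (abs_nonneg _).trans h₁
  set L := (1 + |θ.1|) / θ.2
  have hcost (κ : ℝ) (w : ℕ → ℝ) : avgCost q r θ (ctl D θ κ) t 0 w
      = 1 / (t : ℝ) * (q * traj (sat D κ) 0 w t ^ 2 + ∑ i ∈ Finset.range t,
        (q * traj (sat D κ) 0 w i ^ 2 + r * ctl D θ κ (traj (sat D κ) 0 w i) ^ 2)) := by
    simp only [avgCost, state_eq_traj (closedLoop_ctl (D := D) hθ.ne' κ)]
  unfold expCost
  simp only [hcost]
  have hZ (i : ℕ) : MemLp (fun w : ℕ → ℝ => B + |w (i - 1)|) 2 (noise 𝒟) :=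
    (memLp_const B).add (h𝒟.memLp_eval (i - 1)).abs
  have hU (i : ℕ) : MemLp (fun w : ℕ → ℝ => L * (B + (B + |w (i - 1)|))) 2 (noise 𝒟) :=
    ((memLp_const B).add (hZ i)).const_mul L
  refine continuous_of_dominated (bound := fun w => 1 / (t : ℝ) * (q * (B + |w (t - 1)|) ^ 2
    + ∑ i ∈ Finset.range t, (q * (B + |w (i - 1)|) ^ 2
      + r * (L * (B + (B + |w (i - 1)|))) ^ 2))) (fun κ => ?_) (fun κ => ?_) ?_ ?_
  · have hx := measurable_traj (measurable_sat D κ) 0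
    have hu (i : ℕ) := (measurable_ctl D θ κ).comp (hx i)
    refine Measurable.aestronglyMeasurable (Measurable.const_mul ?_ _)
    refine (((hx t).pow_const 2).const_mul q).add (Finset.measurable_fun_sum _ fun i _ => ?_)
    exact (((hx i).pow_const 2).const_mul q).add (((hu i).pow_const 2).const_mul r)
  · refine Filter.Eventually.of_forall fun w => ?_
    have hx (i : ℕ) : traj (sat D κ) 0 w i ^ 2 ≤ (B + |w (i - 1)|) ^ 2 :=
      sq_le_sq.2 ((abs_traj_sat_le h₁ h₂ κ w i).trans (le_abs_self _))
    have hu (i : ℕ) : ctl D θ κ (traj (sat D κ) 0 w i) ^ 2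
        ≤ (L * (B + (B + |w (i - 1)|))) ^ 2 := by
      refine sq_le_sq.2 (((abs_ctl_le h₁ h₂ hB le_rfl hθ le_rfl κ _).trans ?_).trans
        (le_abs_self _))
      gcongr
      exact abs_traj_sat_le h₁ h₂ κ w i
    rw [Real.norm_eq_abs, abs_of_nonneg (by positivity)]
    refine mul_le_mul_of_nonneg_left (add_le_add (mul_le_mul_of_nonneg_left (hx t) hq)
      (Finset.sum_le_sum fun i _ => ?_)) (by positivity)
    exact add_le_add (mul_le_mul_of_nonneg_left (hx i) hq) (mul_le_mul_of_nonneg_left (hu i) hr)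
  · refine Integrable.const_mul (((hZ t).integrable_sq.const_mul q).add
      (integrable_finsetSum _ fun i _ => ?_)) _
    exact ((hZ i).integrable_sq.const_mul q).add ((hU i).integrable_sq.const_mul r)
  · refine Filter.Eventually.of_forall fun w => ?_
    have hx := continuous_traj_sat D w
    have hu (i : ℕ) : Continuous fun κ => ctl D θ κ (traj (sat D κ) 0 w i) :=
      (((continuous_sat D).comp (continuous_id.prodMk (hx i))).sub
        (continuous_const.mul (hx i))).div_const _
    exact continuous_const.mul ((continuous_const.mul ((hx t).pow 2)).add
      (continuous_finsetSum _ fun i _ => (continuous_const.mul ((hx i).pow 2)).add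
        (continuous_const.mul ((hu i).pow 2))))

lemma truncLin_eq_ctl {D θ : ℝ × ℝ} (hD : D.1 ≤ D.2) (hθ : θ.2 ≠ 0) (K : ℝ) :
    truncLin D θ K = ctl D θ (θ.1 - θ.2 * K) :=
  funext fun x => truncLin_eq hD hθ K x

theorem argminGain_nonempty (h𝒟 : IsNoiseLaw 𝒟) {q r : ℝ} (hq : 0 ≤ q) (hr : 0 ≤ r)
    {D θ : ℝ × ℝ} (hD : D.1 ≤ D.2) (hθ : 0 < θ.2) (t : ℕ) :
    (argminGain q r 𝒟 D θ t).Nonempty := by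
  have hc : Continuous fun K => expCost q r 𝒟 θ (truncLin D θ K) t := by
    simp only [truncLin_eq_ctl hD hθ.ne']
    exact (continuous_expCost_ctl h𝒟 hq hr (le_max_left |D.1| |D.2|) (le_max_right _ _) hθ t).comp
      (by fun_prop)
  obtain ⟨K, hK, hmin⟩ := isCompact_Icc.exists_isMinOn
    (Set.nonempty_Icc.2 (div_le_div_of_nonneg_right (by linarith : θ.1 - 1 ≤ θ.1) hθ.le))
    hc.continuousOn
  exact ⟨K, hK, hmin⟩

end existence

/-! ### Matching of gains and choice of the horizon -/

lemma sub_mul_mem_of_mem_gainRange {θ : ℝ × ℝ} (hθ : 0 < θ.2) {K : ℝ} (hK : K ∈ gainRange θ) :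
    0 ≤ θ.1 - θ.2 * K ∧ θ.1 - θ.2 * K ≤ 1 := by
  have h₁ := (div_le_iff₀ hθ).1 hK.1
  have h₂ := (le_div_iff₀ hθ).1 hK.2
  constructor <;> linarith

/-- A minimizing gain also minimizes over the closed-loop gains `κ ∈ [0, 1]`. -/
lemma expCost_le_of_mem_argminGain {𝒟 : Measure ℝ} {q r : ℝ} {D θ : ℝ × ℝ} (hD : D.1 ≤ D.2) (hθ : 0 < θ.2)
    {t : ℕ} {K : ℝ} (hK : K ∈ argminGain q r 𝒟 D θ t) {κ : ℝ} (hκ0 : 0 ≤ κ) (hκ1 : κ ≤ 1) :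
    expCost q r 𝒟 θ (truncLin D θ K) t ≤ expCost q r 𝒟 θ (ctl D θ κ) t := by
  have hmem : (θ.1 - κ) / θ.2 ∈ gainRange θ := by
    constructor <;> refine div_le_div_of_nonneg_right ?_ hθ.le <;> linarith
  have h := hK.2 hmem
  have e : θ.1 - θ.2 * ((θ.1 - κ) / θ.2) = κ := by field_simp; ring
  simpa only [Set.mem_ofPred_eq, truncLin_eq_ctl hD hθ.ne' ((θ.1 - κ) / θ.2), e] using h

lemma isTildeOmega_radius : IsTildeOmega radius fun _ => 1 :=
  ⟨0, 46, 1, one_pos, fun T _ => by simp [radius]⟩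

lemma tendsto_radius : Filter.Tendsto radius Filter.atTop (nhds 0) := by
  have h : Filter.Tendsto (fun T : ℕ => Real.log T ^ 46) Filter.atTop Filter.atTop :=
    (Filter.tendsto_pow_atTop (by norm_num)).comp
      (Real.tendsto_log_atTop.comp tendsto_natCast_atTop_atTop)
  exact (tendsto_inv_atTop_zero.comp h).congr fun T => by simp [radius]

lemma tendsto_one_div_sq : Filter.Tendsto (fun T : ℕ => 1 / (T : ℝ) ^ 2) Filter.atTop (nhds 0) := by
  have h : Filter.Tendsto (fun T : ℕ => (T : ℝ) ^ 2) Filter.atTop Filter.atTop :=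
    (Filter.tendsto_pow_atTop (by norm_num)).comp tendsto_natCast_atTop_atTop
  simpa [one_div, Function.comp_def] using tendsto_inv_atTop_zero.comp h

end SafeLQR

/-- The norm on `ℝ × ℝ` is the sup norm. The constants `T₀`, `k`, `M` of the bound depend only on
`q, r`, the noise law, the uncertainty box `[aL, aU] × [bL, bU]` and the bound `B` on the
boundaries. -/
theorem lemma2 (q r : ℝ) (hq : 0 < q) (hr : 0 < r)
    (𝒟 : MeasureTheory.Measure ℝ) (h𝒟 : SafeLQR.IsNoiseLaw 𝒟)
    (aL aU bL bU : ℝ) (haL : 0 < aL) (haU : aL ≤ aU) (hbL : 0 < bL) (hbU : bL ≤ bU)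
    (B : ℝ) :
    SafeLQR.IsTildeOmega SafeLQR.radius (fun _ => 1) ∧
    ∃ (T₀ k : ℕ) (M : ℝ), ∀ T : ℕ, T₀ ≤ T →
      ∀ D : ℝ × ℝ, SafeLQR.IsBoundary B T D →
      ∀ θs : ℝ × ℝ, θs ∈ Set.Icc aL aU ×ˢ Set.Icc bL bU →
      ∀ θ : ℝ × ℝ, ‖θ - θs‖ ≤ SafeLQR.radius T →
      ∀ t : ℕ, 1 ≤ t → t ≤ T →
        (SafeLQR.argminGain q r 𝒟 D θ t).Nonempty ∧
        (SafeLQR.argminGain q r 𝒟 D θs t).Nonempty ∧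
        ∀ K ∈ SafeLQR.argminGain q r 𝒟 D θ t,
        ∀ Ks ∈ SafeLQR.argminGain q r 𝒟 D θs t,
          |SafeLQR.expCost q r 𝒟 θs (SafeLQR.truncLin D θ K) t
            - SafeLQR.expCost q r 𝒟 θs (SafeLQR.truncLin D θs Ks) t|
          ≤ M * (‖θ - θs‖ + 1 / (T : ℝ) ^ 2) * Real.log T ^ k := by
  have := h𝒟.isProbabilityMeasure
  refine ⟨SafeLQR.isTildeOmega_radius, ?_⟩
  have hb : 0 < bL / 2 := by positivity
  obtain ⟨M₁, hM₁⟩ := SafeLQR.exists_abs_expCost_sub_le h𝒟 hq.le hr.le (abs_nonneg B)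
    (aU + 1) (bL / 2) bU hb
  obtain ⟨M₂, hM₂⟩ := SafeLQR.exists_abs_expCost_ctl_sub_le h𝒟 hq.le hr.le |B|
    (aU + 1) (bL / 2) bU hb
  set c := bU * ((1 + (aU + 1) + bU) / (bL / 2) ^ 2) with hc
  have hc0 : 0 < c := by
    have : 0 < bU := hbL.trans_le hbU
    have : 0 < aU := haL.trans_le haU
    positivity
  -- The bounds `1` and `bL / 2` keep `θ` bounded with `θ.2 ≥ bL / 2`; `1 / (8 * c)`, applied to
  -- both summands of `ε`, gives `c * ε ≤ 1 / 4`.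
  have hρ : 0 < min (min 1 (bL / 2)) (1 / (8 * c)) := by positivity
  obtain ⟨T₀, hT₀⟩ := Filter.eventually_atTop.1
    (((SafeLQR.tendsto_radius.eventually_le_const hρ).and
      (SafeLQR.tendsto_one_div_sq.eventually_le_const hρ)).and (Filter.eventually_ge_atTop 1))
  refine ⟨T₀, 0, M₁ + M₂, ?_⟩
  intro T hT D hD θs hθs θ hθ t ht _
  obtain ⟨⟨hrad, hsq⟩, hT1⟩ := hT₀ T hT
  have hd := hθ.trans hrad
  have hDB := hD.norm_le.trans (le_abs_self B)
  have h₁ : |D.1| ≤ |B| := (norm_fst_le D).trans hDB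
  have h₂ : |D.2| ≤ |B| := (norm_snd_le D).trans hDB
  have hD12 : D.1 ≤ D.2 := (hD.lower_neg.trans hD.upper_pos).le
  obtain ⟨⟨has₁, has₂⟩, ⟨hbs₁, hbs₂⟩⟩ := hθs
  have hda : |θ.1 - θs.1| ≤ 1 :=
    (norm_fst_le (θ - θs)).trans (hd.trans ((min_le_left _ _).trans (min_le_left _ _)))
  have hdb : |θ.2 - θs.2| ≤ bL / 2 :=
    (norm_snd_le (θ - θs)).trans (hd.trans ((min_le_left _ _).trans (min_le_right _ _)))
  rw [abs_le] at hda hdb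
  have ha : |θ.1| ≤ aU + 1 := abs_le.2 ⟨by linarith, by linarith⟩
  have has : |θs.1| ≤ aU + 1 := abs_le.2 ⟨by linarith, by linarith⟩
  have hbθ : bL / 2 ≤ θ.2 := by linarith
  have hbθs : bL / 2 ≤ θs.2 := by linarith
  have hθ0 : 0 < θ.2 := hb.trans_le hbθ
  have hθs0 : 0 < θs.2 := hb.trans_le hbθs
  -- The term `1 / T²` keeps `ε` positive when `θ = θs`, as Young's inequality requires.
  set ε := ‖θ - θs‖ + 1 / (T : ℝ) ^ 2 with hε
  have hT0 : 0 < 1 / (T : ℝ) ^ 2 := by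
    have : (0 : ℝ) < T := by exact_mod_cast hT1
    positivity
  have hε0 : 0 < ε := add_pos_of_nonneg_of_pos (norm_nonneg _) hT0
  have hθε : ‖θ - θs‖ ≤ ε := by linarith
  have hsmall : c * ε ≤ 1 / 4 := by
    have h : ε ≤ 1 / (8 * c) + 1 / (8 * c) :=
      add_le_add (hd.trans (min_le_right _ _)) (hsq.trans (min_le_right _ _))
    calc c * ε ≤ c * (1 / (8 * c) + 1 / (8 * c)) := by gcongr
      _ = 1 / 4 := by field_simp; norm_num
  refine ⟨SafeLQR.argminGain_nonempty h𝒟 hq.le hr.le hD12 hθ0 t,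
    SafeLQR.argminGain_nonempty h𝒟 hq.le hr.le hD12 hθs0 t, ?_⟩
  intro K hK Ks hKs
  obtain ⟨hκ0, hκ1⟩ := SafeLQR.sub_mul_mem_of_mem_gainRange hθ0 hK.1
  obtain ⟨hκs0, hκs1⟩ := SafeLQR.sub_mul_mem_of_mem_gainRange hθs0 hKs.1
  have hmin := SafeLQR.expCost_le_of_mem_argminGain hD12 hθ0 hK hκs0 hκs1
  have hmins := SafeLQR.expCost_le_of_mem_argminGain hD12 hθs0 hKs hκ0 hκ1
  -- The upper bound follows from `k₁`, minimality for `θ` tested at the gain of `Ks`, and `k₃`; the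
  -- lower bound from minimality for `θs` tested at the gain of `K`, `k₂` and `k₁`.
  have k₁ := hM₁ D θ θs _ ε t h₁ h₂ ha has hbθ hbθs hbs₂ hκ0 hκ1 hε0 hθε hsmall ht
  have k₂ := hM₂ D θ θs (θ.1 - θ.2 * K) ε t h₁ h₂ ha has hbθ hbθs hbs₂ hε0 hθε ht
  have k₃ := hM₂ D θ θs (θs.1 - θs.2 * Ks) ε t h₁ h₂ ha has hbθ hbθs hbs₂ hε0 hθε ht
  rw [SafeLQR.truncLin_eq_ctl hD12 hθ0.ne'] at hmin ⊢
  rw [SafeLQR.truncLin_eq_ctl hD12 hθs0.ne'] at hmins ⊢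
  rw [pow_zero, mul_one]
  rw [abs_le] at *
  constructor <;> linarith
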